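/- **Setting.** Fix $n\ge 1$ bidders and $H>0$. Bidder $i\in[n]$ has a value $v_i$ in a set $T_i\subseteq[0,H]$ and submits a bid $b_i\in[0,H]$. On bids $\boldsymbol b=(b_1,\dots,b_n)$ bidder $i$ receives the item with probability $x_i(\boldsymbol b)=\frac{\mathbb I[b_i=\max_j b_j]}{|\arg\max_j b_j|}$ and pays $p_i(\boldsymbol b)=x_i(\boldsymbol b)f_i(b_i)+g_i(b_i)$, where $f_i,g_i:[0,H]\to[0,H]$ are arbitrary given functions. A joint strategy is $\boldsymbol s=(s_1,\dots,s_n)$ with $s_i:T_i\to[0,H]$; it is monotone if every $s_i$ is weakly increasing. For a product distribution $\boldsymbol D=\prod_i D_i$ on $\prod_i T_i$ and monotone $\boldsymbol s$, the interim utility of bidder $i$ with value $v_i$ and bid $b_i$ is $$u_i^{\boldsymbol D}(v_i,b_i,\boldsymbol s_{-i})=\mathbb E_{\boldsymbol v_{-i}\sim\prod_{j\ne i}D_j}\big[v_i\,x_i(b_i,\boldsymbol s_{-i}(\boldsymbol v_{-i}))-p_i(b_i,\boldsymbol s_{-i}(\boldsymbol v_{-i}))\big].$$ For $\eta\ge 0$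 let $\mathrm{BNE}(\boldsymbol D,\eta)$ be the set of monotone joint strategies $\boldsymbol s$ with $u_i^{\boldsymbol D}(v_i,s_i(v_i),\boldsymbol s_{-i})\ge u_i^{\boldsymbol D}(v_i,b',\boldsymbol s_{-i})-\eta$ for all $i\in[n]$, $v_i\in T_i$ and $b'\in[0,H]$. Given samples $\boldsymbol v^{(1)},\dots,\boldsymbol v^{(m)}\in\prod_i T_i$, $m\ge1$, the empirical product distribution is $\hat{\boldsymbol D}=\prod_i\hat D_i$ with $\hat D_i=\frac1m\sum_{j=1}^m\delta_{v_i^{(j)}}$ (the same sets $T_i$ are used for $\boldsymbol D$ and $\hat{\boldsymbol D}$). **Theorem.** There is an absolute constant $C>0$ such that the following holds for all $n\ge1$, $H>0$, all $f_i,g_i$, all $T_i\subseteq[0,H]$, all product distributions $\boldsymbol D=\prod_{i=1}^n D_i$ on $\prod_{i=1}^n T_i$, all $\varepsilon,\varepsilon'>0$, $\delta\in(0,1)$, and all integers $m\ge1$ with $$m\;\ge\; C\,\frac{H^2}{\varepsilon^2}\Big[n\log n\,\log\Big(\frac H\varepsilon\Big)+\log\Big(\frac n\delta\Big)\Big].$$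 If $\boldsymbol v^{(1)},\dots,\boldsymbol v^{(m)}$ are drawn i.i.d. from $\boldsymbol D$, then with probability at least $1-\delta$, $$\mathrm{BNE}(\hat{\boldsymbol D},\varepsilon')\subseteq\mathrm{BNE}(\boldsymbol D,\varepsilon'+2\varepsilon)\quad\text{and}\quad\mathrm{BNE}(\boldsymbol D,\varepsilon')\subseteq\mathrm{BNE}(\hat{\boldsymbol D},\varepsilon'+2\varepsilon).$$ -/

import Mathlib

open MeasureTheory

noncomputable section

namespace BayesAuction

/-- Bids lie in `[0, H]`. -/
abbrev Bid (H : ℝ) : Type := Set.Icc (0 : ℝ) H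

/-- Highest-bid-wins allocation with ties broken uniformly at random: bidder `i` receives the item
with probability `1 / |argmax b|` if `b i` is a maximal bid, and with probability `0` otherwise. -/
def alloc {n : ℕ} {H : ℝ} (i : Fin n) (b : Fin n → Bid H) : ℝ :=
  open Classical in
  if ∀ j, b j ≤ b i then
    1 / ((Finset.univ.filter (fun j : Fin n => ∀ k, b k ≤ b j)).card : ℝ)
  else 0

/-- Payment `p_i(b) = x_i(b) f_i(b_i) + g_i(b_i)`. -/
def payment {n : ℕ} {H : ℝ} (f g : Fin n → Bid H → Set.Icc (0 : ℝ) H)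
    (i : Fin n) (b : Fin n → Bid H) : ℝ :=
  alloc i b * (f i (b i) : ℝ) + (g i (b i) : ℝ)

/-- Ex post utility `U_i(v_i, b) = v_i x_i(b) - p_i(b)`. -/
def exPostUtility {n : ℕ} {H : ℝ} (f g : Fin n → Bid H → Set.Icc (0 : ℝ) H)
    (i : Fin n) (v : ℝ) (b : Fin n → Bid H) : ℝ :=
  v * alloc i b - payment f g i b

/-- Joint (pure) bidding strategies `s_i : T_i → [0, H]`. -/
abbrev Strategy {n : ℕ} (H : ℝ) (T : Fin n → Set ℝ) : Type :=
  (i : Fin n) → T i → Bid H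

/-- The bid vector `(bi, s_{-i}(v_{-i}))`. -/
def bidProfile {n : ℕ} {H : ℝ} {T : Fin n → Set ℝ} (s : Strategy H T) (i : Fin n) (bi : Bid H)
    (w : (j : {j : Fin n // j ≠ i}) → T j.1) : Fin n → Bid H :=
  fun j => if h : j = i then bi else s j (w ⟨j, h⟩)

/-- Interim utility of bidder `i` with value `v` and bid `bi`: the expectation of
`U_i(v, (bi, s_{-i}(v_{-i})))` over `v_{-i}` drawn from the product of the `D_j`, `j ≠ i`. -/
def interimUtility {n : ℕ} {H : ℝ} {T : Fin n → Set ℝ}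
    (f g : Fin n → Bid H → Set.Icc (0 : ℝ) H) (D : (i : Fin n) → Measure (T i))
    (i : Fin n) (v : ℝ) (bi : Bid H) (s : Strategy H T) : ℝ :=
  ∫ w, exPostUtility f g i v (bidProfile s i bi w)
    ∂(Measure.pi (fun j : {j : Fin n // j ≠ i} => D j.1))

/-- `s` is a (pure-strategy) `ε`-Bayes Nash equilibrium for the value distribution `∏ i, D i`. -/
def IsBNE {n : ℕ} {H : ℝ} {T : Fin n → Set ℝ}
    (f g : Fin n → Bid H → Set.Icc (0 : ℝ) H) (D : (i : Fin n) → Measure (T i))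
    (ε : ℝ) (s : Strategy H T) : Prop :=
  ∀ (i : Fin n) (v : T i) (b' : Bid H),
    interimUtility f g D i v (s i v) s ≥ interimUtility f g D i v b' s - ε

/-- The set of monotone `ε`-Bayes Nash equilibria for the value distribution `∏ i, D i`. -/
def BNE {n : ℕ} {H : ℝ} {T : Fin n → Set ℝ}
    (f g : Fin n → Bid H → Set.Icc (0 : ℝ) H) (D : (i : Fin n) → Measure (T i))
    (ε : ℝ) : Set (Strategy H T) :=
  {s | (∀ i, Monotone (s i)) ∧ IsBNE f g D ε s}

/-- Marginals of the empirical product distribution: the value of bidder `i` is drawn uniformly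
from the `m` sampled values of bidder `i` (counted with multiplicity). -/
def empMarginal {n m : ℕ} {T : Fin n → Set ℝ} (S : Fin m → (i : Fin n) → T i) (i : Fin n) :
    Measure (T i) :=
  (m : ENNReal)⁻¹ • ∑ j : Fin m, Measure.dirac (S j i)

end BayesAuction

end

/-! For monotone strategies the interim utility is `(v - f i b) * winProb - g i b`, and only
`winProb` depends on the value distribution. Since `|v - f i b| ≤ H`, estimating every winning
probability within `ε / H` changes the gain from any deviation by at most `2 * ε`, which gives both
inclusions.

The winning probability is the expectation of `winShare` on the sets where opponents bid strictly,
respectively weakly, below `b`. By monotonicity these are lower sets of a linear order, so `N`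
brackets of mass `1 / N` per opponent cover them, whatever the strategies are
(`exists_lowerSet_brackets`). With `N` of order `n / e` for accuracy `e`, a union bound over the
brackets suffices (`exists_uniform_winShare`).

For one fixed function, the expectation under the product of empirical marginals is not a mean of
independent terms, but it is an average of such means, one for each coordinatewise cyclic shift of
the sample. Every shifted sample has the law of the original, so Jensen's inequality transfers the
sub-Gaussian bound, as in Hoeffding's treatment of U-statistics (`hasSubgaussianMGF_empirical`).

Where the sample bound degenerates, no sampling is needed: for `H ≤ 2 * ε` any two distributions
give gains within `H` (`deviation_gain_sub_le`), and for `n = 1` there are no opponents. -/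

noncomputable section

namespace BayesAuction

open ProbabilityTheory

/-! ### Concentration for the product of the empirical marginals. -/

section Concentration

variable {ι : Type*} {X : ι → Type*} [∀ j, MeasurableSpace (X j)] {m : ℕ}

/-- The empirical marginals of a sample of `m` points of a product space. -/
def empirical (S : Fin m → ∀ j, X j) (j : ι) : Measure (X j) :=
  (m : ENNReal)⁻¹ • ∑ t : Fin m, Measure.dirac (S t j)

instance isProbabilityMeasure_empirical [NeZero m] (S : Fin m → ∀ j, X j) (j : ι) :
    IsProbabilityMeasure (empirical S j) := by
  constructor
  simp only [empirical, Measure.smul_apply, Measure.coe_finsetSum, Finset.sum_apply,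
    measure_univ, smul_eq_mul, Finset.sum_const, Finset.card_univ, Fintype.card_fin, nsmul_eq_mul,
    mul_one]
  exact ENNReal.inv_mul_cancel (by simp [NeZero.ne m]) (by simp)

/-- Coordinatewise cyclic shifts of the sample indices. -/
def shiftSample [NeZero m] (k : ι → Fin m) (S : Fin m → ∀ j, X j) : Fin m → ∀ j, X j :=
  fun t j => S (t + k j) j

lemma measurable_shiftSample [NeZero m] (k : ι → Fin m) :
    Measurable (shiftSample (X := X) k) := by
  unfold shiftSample; fun_prop

/-- Hoeffding's lemma gives variance proxy `1/4` for range one; summing `m` independent copies and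
scaling by `m⁻¹` gives `m * (1/4) * m⁻²`. -/
lemma hasSubgaussianMGF_sampleMean [NeZero m] {Ω : Type*} [MeasurableSpace Ω] (μ : Measure Ω)
    [IsProbabilityMeasure μ] {h : Ω → ℝ} (hm : Measurable h) {a : ℝ}
    (hb : ∀ x, h x ∈ Set.Icc a (a + 1)) :
    HasSubgaussianMGF (fun S : Fin m → Ω => (m : ℝ)⁻¹ * ∑ t, (h (S t) - ∫ w, h w ∂μ))
      (4 * m)⁻¹ (Measure.pi fun _ : Fin m => μ) := by
  have h1 : HasSubgaussianMGF (fun w => h w - ∫ w, h w ∂μ) (1 / 4) μ := by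
    have := hasSubgaussianMGF_of_mem_Icc (μ := μ) hm.aemeasurable (ae_of_all _ hb)
    convert this using 1
    norm_num
  have h2 : iIndepFun (fun (t : Fin m) (S : Fin m → Ω) => h (S t) - ∫ w, h w ∂μ)
      (Measure.pi fun _ : Fin m => μ) :=
    iIndepFun_pi (X := fun _ w => h w - ∫ w, h w ∂μ) (fun _ => (hm.sub_const _).aemeasurable)
  have h3 := (HasSubgaussianMGF.sum_of_iIndepFun h2 (c := fun _ => 1 / 4) (s := Finset.univ)
    (fun t _ => by
      refine HasSubgaussianMGF.of_map (X := fun w => h w - ∫ w, h w ∂μ)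
        (Y := fun S : Fin m → Ω => S t) (measurable_pi_apply t).aemeasurable ?_
      rw [(measurePreserving_eval (fun _ : Fin m => μ) t).map_eq]
      exact h1)).const_mul (m : ℝ)⁻¹
  convert h3 using 1
  have hm0 : (m : ℝ) ≠ 0 := by exact_mod_cast NeZero.ne m
  refine NNReal.eq ?_
  change _ = ((m : ℝ)⁻¹ ^ 2) * ((∑ _t : Fin m, (1 / 4 : NNReal) : NNReal) : ℝ)
  push_cast
  simp
  field_simp

variable [Fintype ι]

/-- A shift permutes the i.i.d. draws within each coordinate, and coordinates are independent, so
the law is unchanged. It is enough to compare masses on boxes of boxes. -/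
lemma measurePreserving_shiftSample [NeZero m] (D : ∀ j, Measure (X j))
    [∀ j, IsProbabilityMeasure (D j)] (k : ι → Fin m) :
    MeasurePreserving (shiftSample k) (Measure.pi fun _ : Fin m => Measure.pi D)
      (Measure.pi fun _ : Fin m => Measure.pi D) := by
  refine ⟨measurable_shiftSample k, Eq.symm ?_⟩
  refine Measure.pi_eq_generateFrom
    (C := fun _ => Set.pi Set.univ '' Set.pi Set.univ fun j => {s : Set (X j) | MeasurableSet s})
    (fun _ => generateFrom_pi) (fun _ => isPiSystem_pi)
    (fun _ => ⟨fun _ => Set.univ, fun _ => ⟨fun _ => Set.univ, by simp, by simp⟩, by simp,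
      by simp [Set.iUnion_const]⟩) ?_
  intro s hs
  choose B hB hBs using hs
  have hBm : ∀ t, MeasurableSet (Set.pi Set.univ (B t)) := fun t =>
    MeasurableSet.univ_pi fun j => hB t j trivial
  obtain rfl : s = fun t => Set.pi Set.univ (B t) := funext fun t => (hBs t).symm
  refine (Measure.map_apply (measurable_shiftSample k)
    (MeasurableSet.univ_pi hBm)).trans ?_
  have : shiftSample k ⁻¹' (Set.pi Set.univ fun t => Set.pi Set.univ (B t)) =
      Set.pi Set.univ fun t => Set.pi Set.univ fun j => B (t - k j) j := by
    ext S
    simp only [Set.mem_preimage, Set.mem_pi, Set.mem_univ, true_implies, shiftSample]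
    constructor
    · intro h t j
      simpa using h (t - k j) j
    · intro h t j
      simpa using h (t + k j) j
  rw [this]
  simp only [Measure.pi_pi]
  rw [Finset.prod_comm]
  conv_rhs => rw [Finset.prod_comm]
  refine Finset.prod_congr rfl fun j _ => ?_
  exact Fintype.prod_equiv (Equiv.subRight (k j)) _ _ fun t => rfl

variable [DecidableEq ι]

/-- The product of the empirical marginals is the uniform distribution over all ways of choosing
one sample index per coordinate. -/
lemma pi_empirical [NeZero m] (S : Fin m → ∀ j, X j) :
    Measure.pi (empirical S) =
      ((m : ENNReal)⁻¹ ^ Fintype.card ι) • ∑ k : ι → Fin m, Measure.dirac (fun j => S (k j) j) := by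
  refine Measure.pi_eq fun B hB => ?_
  simp only [empirical, Measure.smul_apply, Measure.coe_finsetSum, Finset.sum_apply, smul_eq_mul]
  rw [Finset.prod_mul_distrib, Finset.prod_const, Finset.card_univ, Finset.prod_univ_sum,
    Fintype.piFinset_univ]
  congr 1
  refine Finset.sum_congr rfl fun k _ => ?_
  rw [Measure.dirac_apply' _ (MeasurableSet.univ_pi hB)]
  simp_rw [Measure.dirac_apply' _ (hB _)]
  by_cases h : ∀ j, S (k j) j ∈ B j
  · simp [Set.indicator_of_mem, h]
  · push Not at h
    obtain ⟨j, hj⟩ := h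
    rw [Set.indicator_of_notMem (fun hh : (fun j => S (k j) j) ∈ Set.pi Set.univ B => hj (hh j trivial)),
      Finset.prod_eq_zero (Finset.mem_univ j) (Set.indicator_of_notMem hj _)]

lemma integral_pi_empirical [NeZero m] (S : Fin m → ∀ j, X j) {h : (∀ j, X j) → ℝ}
    (hm : Measurable h) :
    ∫ w, h w ∂(Measure.pi (empirical S)) =
      ∑ k : ι → Fin m, ((m : ℝ)⁻¹ ^ Fintype.card ι) * h (fun j => S (k j) j) := by
  rw [pi_empirical, integral_smul_measure, integral_finsetSum_measure]
  · simp [integral_dirac' _ _ hm.stronglyMeasurable, Finset.mul_sum]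
  · intro k _
    exact (integrable_dirac' hm.stronglyMeasurable (by simp))

/-- The empirical product expectation is the average over shifts of sample means. -/
lemma integral_pi_empirical_eq_shift [NeZero m] (S : Fin m → ∀ j, X j) {h : (∀ j, X j) → ℝ}
    (hm : Measurable h) :
    ∫ w, h w ∂(Measure.pi (empirical S)) =
      ∑ k : ι → Fin m, ((m : ℝ)⁻¹ ^ Fintype.card ι) *
        ((m : ℝ)⁻¹ * ∑ t, h (shiftSample k S t)) := by
  rw [integral_pi_empirical S hm]
  simp_rw [← Finset.mul_sum]
  congr 1
  rw [Finset.sum_comm]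
  -- Translating `k` by the constant `t` removes the dependence on `t`, so the additional average
  -- over `t` changes nothing.
  have : ∀ t : Fin m, ∑ k : ι → Fin m, h (shiftSample k S t) =
      ∑ k : ι → Fin m, h (fun j => S (k j) j) := fun t =>
    Fintype.sum_equiv (Equiv.addLeft (fun _ => t)) _ _ fun k => rfl
  simp_rw [this]
  have hm0 : (m : ℝ) ≠ 0 := by exact_mod_cast NeZero.ne m
  simp [hm0]

/-- The shifted sample means are dependent, but convexity of `exp` bounds the mgf of their average
by the average of their mgfs, all equal to that of one sample mean. Allowing any `a` lets the bound
apply to `-h` as well. -/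
lemma hasSubgaussianMGF_empirical [NeZero m] (D : ∀ j, Measure (X j))
    [∀ j, IsProbabilityMeasure (D j)] {h : (∀ j, X j) → ℝ} (hm : Measurable h) {a : ℝ}
    (hb : ∀ x, h x ∈ Set.Icc a (a + 1)) :
    HasSubgaussianMGF (fun S : Fin m → ∀ j, X j =>
        ∫ w, h w ∂(Measure.pi (empirical S)) - ∫ w, h w ∂(Measure.pi D))
      (4 * m)⁻¹ (Measure.pi fun _ : Fin m => Measure.pi D) := by
  set P := Measure.pi fun _ : Fin m => Measure.pi D
  set c : ℝ := ∫ w, h w ∂(Measure.pi D)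
  have hm0 : (m : ℝ) ≠ 0 := by exact_mod_cast NeZero.ne m
  set Z : (Fin m → ∀ j, X j) → ℝ := fun S => (m : ℝ)⁻¹ * ∑ t, (h (S t) - c) with hZ
  have hsub : HasSubgaussianMGF Z (4 * m)⁻¹ P := hasSubgaussianMGF_sampleMean (Measure.pi D) hm hb
  have hZm : Measurable Z := by fun_prop
  set q : ℝ := (m : ℝ)⁻¹ ^ Fintype.card ι with hq
  have hq0 : 0 ≤ q := by positivity
  have hq1 : ∑ _k : ι → Fin m, q = 1 := by
    simp [hq, hm0]
  have key : ∀ S, ∫ w, h w ∂(Measure.pi (empirical S)) - c =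
      ∑ k : ι → Fin m, q • Z (shiftSample k S) := by
    intro S
    rw [integral_pi_empirical_eq_shift S hm]
    have : c = ∑ _k : ι → Fin m, q * c := by rw [← Finset.sum_mul, hq1, one_mul]
    rw [this, ← Finset.sum_sub_distrib]
    refine Finset.sum_congr rfl fun k _ => ?_
    rw [hZ, smul_eq_mul, ← mul_sub]
    congr 1
    simp [Finset.sum_sub_distrib, mul_sub, hm0]
  have hint : ∀ (t : ℝ) (k : ι → Fin m),
      Integrable (fun S => Real.exp (t * Z (shiftSample k S))) P := fun t k =>
    ((measurePreserving_shiftSample D k).integrable_comp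
      (by fun_prop : Measurable fun S => Real.exp (t * Z S)).aestronglyMeasurable).2
      (hsub.integrable_exp_mul t)
  have hle : ∀ (t : ℝ) S, Real.exp (t * ∑ k : ι → Fin m, q • Z (shiftSample k S)) ≤
      ∑ k : ι → Fin m, q * Real.exp (t * Z (shiftSample k S)) := by
    intro t S
    have := convexOn_exp.map_sum_le (t := Finset.univ) (w := fun _ : ι → Fin m => q)
      (p := fun k => t * Z (shiftSample k S)) (fun _ _ => hq0) hq1 (fun _ _ => trivial)
    refine le_trans (le_of_eq ?_) this
    congr 1
    rw [Finset.mul_sum]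
    refine Finset.sum_congr rfl fun k _ => ?_
    simp only [smul_eq_mul]; ring
  have hint' : ∀ t : ℝ, Integrable
      (fun S => ∑ k : ι → Fin m, q * Real.exp (t * Z (shiftSample k S))) P := fun t =>
    integrable_finsetSum _ fun k _ => (hint t k).const_mul q
  have hint2 : ∀ t : ℝ, Integrable
      (fun S => Real.exp (t * ∑ k : ι → Fin m, q • Z (shiftSample k S))) P := by
    intro t
    refine (hint' t).mono' ?_ (ae_of_all _ fun S => ?_)
    · exact (Real.measurable_exp.comp ((Finset.measurable_fun_sum _ fun k _ =>
        (hZm.comp (measurable_shiftSample k)).const_smul q).const_mul t)).aestronglyMeasurable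
    · rw [Real.norm_of_nonneg (Real.exp_pos _).le]
      exact hle t S
  simp_rw [key]
  refine ⟨hint2, fun t => ?_⟩
  calc mgf (fun S => ∑ k : ι → Fin m, q • Z (shiftSample k S)) P t
      ≤ ∫ S, ∑ k : ι → Fin m, q * Real.exp (t * Z (shiftSample k S)) ∂P :=
        integral_mono (hint2 t) (hint' t) (hle t)
    _ = ∑ _k : ι → Fin m, q * mgf Z P t := by
        rw [integral_finsetSum _ fun k _ => (hint t k).const_mul q]
        refine Finset.sum_congr rfl fun k _ => ?_
        rw [integral_const_mul]
        congr 1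
        have hmp := measurePreserving_shiftSample (m := m) D k
        have := integral_map (μ := P) hmp.measurable.aemeasurable
          (by fun_prop : Measurable fun S => Real.exp (t * Z S)).aestronglyMeasurable
        rw [hmp.map_eq] at this
        exact this.symm
    _ = mgf Z P t := by rw [← Finset.sum_mul, hq1, one_mul]
    _ ≤ _ := hsub.mgf_le t

/-- **Hoeffding's inequality** for the product of the empirical marginals. -/
lemma measure_empirical_sub_ge_le [NeZero m] (D : ∀ j, Measure (X j))
    [∀ j, IsProbabilityMeasure (D j)] {h : (∀ j, X j) → ℝ} (hm : Measurable h) {a : ℝ}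
    (hb : ∀ x, h x ∈ Set.Icc a (a + 1)) {t : ℝ} (ht : 0 ≤ t) :
    (Measure.pi fun _ : Fin m => Measure.pi D).real {S : Fin m → ∀ j, X j |
        t ≤ ∫ w, h w ∂(Measure.pi (empirical S)) - ∫ w, h w ∂(Measure.pi D)} ≤
      Real.exp (-(2 * m * t ^ 2)) := by
  refine ((hasSubgaussianMGF_empirical D hm hb).measure_ge_le ht).trans (le_of_eq ?_)
  congr 1
  have hm0 : (m : ℝ) ≠ 0 := by exact_mod_cast NeZero.ne m
  push_cast
  field_simp
  ring

lemma measurable_integral_empirical [NeZero m] {h : (∀ j, X j) → ℝ} (hm : Measurable h) :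
    Measurable fun S : Fin m → ∀ j, X j => ∫ w, h w ∂(Measure.pi (empirical S)) := by
  simp_rw [fun S => integral_pi_empirical (m := m) S hm]
  fun_prop

end Concentration

/-! ### Bracketing lower sets of a linear order by mass, atoms allowed. -/

section LowerSets

variable {α : Type*} [LinearOrder α]

lemma IsLowerSet.eq_iUnion_Iio {U : Set α} (hU : IsLowerSet U)
    (h : ¬ ∃ x ∈ U, ∀ y ∈ U, y ≤ x) : U = ⋃ x ∈ U, Set.Iio x := by
  push Not at h
  ext y
  simp only [Set.mem_iUnion, Set.mem_Iio, exists_prop]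
  exact ⟨fun hy => h y hy, fun ⟨x, hx, hyx⟩ => hU hyx.le hx⟩

variable [TopologicalSpace α] [OrderClosedTopology α] [MeasurableSpace α]

/-- If the union has a greatest element, the lower set containing that element is already
everything. Otherwise the union is a countable directed union of rays `Iio x`, each inside a member,
and continuity from below applies. -/
lemma measure_sUnion_isLowerSet_le [SecondCountableTopology α] (μ : Measure α) (c : ENNReal) :
    μ (⋃₀ {L | IsLowerSet L ∧ μ L ≤ c}) ≤ c := by
  set U := ⋃₀ {L | IsLowerSet L ∧ μ L ≤ c}
  have hU : IsLowerSet U := isLowerSet_sUnion fun L hL => hL.1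
  by_cases h : ∃ x ∈ U, ∀ y ∈ U, y ≤ x
  · obtain ⟨x, ⟨L, ⟨hL, hc⟩, hxL⟩, hy⟩ := h
    exact (measure_mono fun y hyU => hL (hy y hyU) hxL).trans hc
  · obtain ⟨C, hCU, hC, hC'⟩ := TopologicalSpace.isOpen_biUnion_countable U Set.Iio
      fun _ _ => isOpen_Iio
    rw [IsLowerSet.eq_iUnion_Iio hU h, ← hC', measure_biUnion_eq_iSup hC]
    · refine iSup₂_le fun x hx => ?_
      obtain ⟨L, ⟨hL, hc⟩, hxL⟩ := hCU hx
      exact (measure_mono fun y hy => hL (le_of_lt hy) hxL).trans hc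
    · intro x hx y hy
      exact ⟨max x y, by rcases max_cases x y with h | h <;> simp [h.1, hx, hy],
        Set.Iio_subset_Iio (le_max_left _ _), Set.Iio_subset_Iio (le_max_right _ _)⟩

lemma measure_sUnion_isUpperSet_le [SecondCountableTopology α] (μ : Measure α) (c : ENNReal) :
    μ (⋃₀ {V | IsUpperSet V ∧ μ V ≤ c}) ≤ c :=
  measure_sUnion_isLowerSet_le (α := αᵒᵈ) μ c

variable [OpensMeasurableSpace α]

lemma IsLowerSet.measurableSet' {U : Set α} (hU : IsLowerSet U) : MeasurableSet U := by
  by_cases h : ∃ x ∈ U, ∀ y ∈ U, y ≤ x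
  · obtain ⟨x, hx, hy⟩ := h
    rw [show U = Set.Iic x from Set.Subset.antisymm hy fun y hyx => hU hyx hx]
    exact isClosed_Iic.measurableSet
  · rw [IsLowerSet.eq_iUnion_Iio hU h]
    exact (isOpen_biUnion fun _ _ => isOpen_Iio).measurableSet

/-- The lower sets of a probability space are covered by `N` brackets of mass `1 / N`. -/
lemma exists_lowerSet_brackets [SecondCountableTopology α] (μ : Measure α)
    [IsProbabilityMeasure μ] {N : ℕ} (hN : 0 < N) :
    ∃ lo hi : Fin N → Set α, (∀ k, IsLowerSet (lo k)) ∧ (∀ k, IsLowerSet (hi k)) ∧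
      ∀ L, IsLowerSet L → ∃ k, lo k ⊆ L ∧ L ⊆ hi k ∧ μ.real (hi k \ lo k) ≤ 1 / N := by
  have hN0 : (0 : ℝ) < N := by exact_mod_cast hN
  -- `hi k` is the largest lower set allowed by the mass bound `(k + 1) / N`; `lo k` is dual, its
  -- complement being the largest upper set allowed by `1 - k / N`.
  refine ⟨fun k => (⋃₀ {V | IsUpperSet V ∧ μ V ≤ ENNReal.ofReal (1 - k / N)})ᶜ,
    fun k => ⋃₀ {L | IsLowerSet L ∧ μ L ≤ ENNReal.ofReal ((k + 1) / N)}, fun k => ?_, fun k => ?_,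
    fun L hL => ?_⟩
  · exact IsUpperSet.compl (isUpperSet_sUnion fun V hV => hV.1)
  · exact isLowerSet_sUnion fun L hL => hL.1
  have hp0 : 0 ≤ μ.real L := measureReal_nonneg
  have hp1 : μ.real L ≤ 1 := measureReal_le_one
  obtain ⟨k, hk1, hk2⟩ : ∃ k : Fin N, (k : ℝ) / N ≤ μ.real L ∧ μ.real L ≤ (k + 1) / N := by
    -- Taking the floor would send mass `1` to the nonexistent cell `N`, so it is put in the last
    -- one.
    by_cases hp : μ.real L = 1
    · refine ⟨⟨N - 1, by omega⟩, ?_, ?_⟩ <;> simp only [Nat.cast_sub (show 1 ≤ N from hN)]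
      · rw [hp, div_le_one hN0]; simp
      · rw [hp, le_div_iff₀ hN0]; simp
    · have hlt : μ.real L < 1 := lt_of_le_of_ne hp1 hp
      refine ⟨⟨⌊μ.real L * N⌋₊, ?_⟩, ?_, ?_⟩
      · rw [Nat.floor_lt (by positivity)]
        nlinarith
      · rw [div_le_iff₀ hN0]
        exact Nat.floor_le (by positivity)
      · rw [le_div_iff₀ hN0]
        exact (Nat.lt_floor_add_one _).le
  refine ⟨k, ?_, ?_, ?_⟩
  · refine Set.compl_subset_comm.1 (Set.subset_sUnion_of_mem ⟨hL.compl, ?_⟩)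
    rw [← ofReal_measureReal, probReal_compl_eq_one_sub (IsLowerSet.measurableSet' hL)]
    exact ENNReal.ofReal_le_ofReal (by linarith)
  · refine Set.subset_sUnion_of_mem ⟨hL, ?_⟩
    rw [← ofReal_measureReal]
    exact ENNReal.ofReal_le_ofReal hk2
  · set V := ⋃₀ {V | IsUpperSet V ∧ μ V ≤ ENNReal.ofReal (1 - k / N)} with hV
    set W := ⋃₀ {L | IsLowerSet L ∧ μ L ≤ ENNReal.ofReal ((k + 1) / N)} with hW
    have hVup : IsUpperSet V := isUpperSet_sUnion fun V hV => hV.1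
    have hVm : MeasurableSet V := by
      rw [← compl_compl V]; exact (IsLowerSet.measurableSet' hVup.compl).compl
    have hV1 : μ.real V ≤ 1 - k / N := by
      refine ENNReal.toReal_le_of_le_ofReal (by linarith) (measure_sUnion_isUpperSet_le μ _)
    have hW1 : μ.real W ≤ (k + 1) / N := by
      refine ENNReal.toReal_le_of_le_ofReal (by positivity) (measure_sUnion_isLowerSet_le μ _)
    -- The inclusion goes through `L`: it can fail for a `k` whose mass interval is jumped over by
    -- an atom.
    have hsub : Vᶜ ⊆ W := by
      refine Set.Subset.trans (b := L) ?_ ?_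
      · refine Set.compl_subset_comm.1 (Set.subset_sUnion_of_mem ⟨hL.compl, ?_⟩)
        rw [← ofReal_measureReal, probReal_compl_eq_one_sub (IsLowerSet.measurableSet' hL)]
        exact ENNReal.ofReal_le_ofReal (by linarith)
      · refine Set.subset_sUnion_of_mem ⟨hL, ?_⟩
        rw [← ofReal_measureReal]
        exact ENNReal.ofReal_le_ofReal hk2
    rw [measureReal_sdiff hsub hVm.compl, probReal_compl_eq_one_sub hVm]
    have : ((k : ℝ) + 1) / N = k / N + 1 / N := by ring
    linarith

end LowerSets

/-! ### The winning share and its stability under bracketing. -/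

section WinShare

variable {ι : Type*} [Fintype ι] {X : ι → Type*}

open Classical in
/-- The winning probability against opponents with values `w`, when opponent `j` bids strictly
below on `A j` and weakly below on `B j`. -/
def winShare (A B : ∀ j, Set (X j)) (w : ∀ j, X j) : ℝ :=
  if ∀ j, w j ∈ B j then 1 / (1 + ((Finset.univ.filter fun j => w j ∉ A j).card : ℝ)) else 0

lemma winShare_mem_Icc (A B : ∀ j, Set (X j)) (w : ∀ j, X j) :
    winShare A B w ∈ Set.Icc (0 : ℝ) 1 := by
  unfold winShare
  split_ifs
  · refine ⟨by positivity, ?_⟩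
    rw [div_le_one (by positivity)]
    simp
  · simp

lemma winShare_mono {A A' B B' : ∀ j, Set (X j)} (hA : ∀ j, A j ⊆ A' j) (hB : ∀ j, B j ⊆ B' j)
    (w : ∀ j, X j) : winShare A B w ≤ winShare A' B' w := by
  unfold winShare
  split_ifs with h1 h2
  · gcongr with j
    exact hA j
  · exact absurd (fun j => hB j (h1 j)) h2
  · positivity
  · rfl

-- The two shares agree unless some coordinate falls in a gap, and they never differ by more than
-- one.
open Classical in
lemma winShare_sub_le {A A' B B' : ∀ j, Set (X j)} (hA : ∀ j, A j ⊆ A' j)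
    (hB : ∀ j, B j ⊆ B' j) (w : ∀ j, X j) :
    winShare A' B' w - winShare A B w ≤
      ∑ j, ((A' j \ A j).indicator 1 (w j) + (B' j \ B j).indicator 1 (w j)) := by
  have hnn : ∀ j, (0 : ℝ) ≤ (A' j \ A j).indicator 1 (w j) + (B' j \ B j).indicator 1 (w j) :=
    fun j => add_nonneg (Set.indicator_nonneg (by simp) _) (Set.indicator_nonneg (by simp) _)
  by_cases h : ∃ j, w j ∈ A' j \ A j ∨ w j ∈ B' j \ B j
  · obtain ⟨j, hj⟩ := h
    have h1 : (1 : ℝ) ≤ (A' j \ A j).indicator 1 (w j) + (B' j \ B j).indicator 1 (w j) := by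
      rcases hj with hj | hj
      · rw [Set.indicator_of_mem hj]
        simpa using Set.indicator_nonneg (by simp) _
      · rw [Set.indicator_of_mem (s := B' j \ B j) hj]
        simpa using Set.indicator_nonneg (by simp) _
    have h2 := Finset.single_le_sum (fun j _ => hnn j) (Finset.mem_univ j)
    have h3 := (winShare_mem_Icc A' B' w).2
    have h4 := (winShare_mem_Icc A B w).1
    linarith
  · push Not at h
    have hA' : ∀ j, w j ∈ A j ↔ w j ∈ A' j := fun j =>
      ⟨fun hj => hA j hj, fun hj => by by_contra h'; exact (h j).1 ⟨hj, h'⟩⟩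
    have hB' : ∀ j, w j ∈ B j ↔ w j ∈ B' j := fun j =>
      ⟨fun hj => hB j hj, fun hj => by by_contra h'; exact (h j).2 ⟨hj, h'⟩⟩
    have : winShare A' B' w = winShare A B w := by simp [winShare, hA', hB']
    rw [this, sub_self]
    exact Finset.sum_nonneg fun j _ => hnn j

variable [∀ j, MeasurableSpace (X j)]

lemma measurable_winShare {A B : ∀ j, Set (X j)} (hA : ∀ j, MeasurableSet (A j))
    (hB : ∀ j, MeasurableSet (B j)) : Measurable (winShare A B) := by
  classical
  have h : winShare A B = fun w => if ∀ j, w j ∈ B j then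
      1 / (1 + ∑ j, (if w j ∉ A j then (1 : ℝ) else 0)) else 0 := by
    ext w
    simp only [winShare, Finset.sum_boole]
  rw [h]
  refine Measurable.ite ?_ ?_ measurable_const
  · rw [Set.ofPred_forall]
    exact MeasurableSet.iInter fun j => measurable_pi_apply j (hB j)
  · refine Measurable.const_div (measurable_const.add (Finset.measurable_fun_sum _ fun j _ => ?_)) _
    exact Measurable.ite (measurable_pi_apply j (hA j).compl) measurable_const measurable_const

lemma integrable_winShare {A B : ∀ j, Set (X j)} (hA : ∀ j, MeasurableSet (A j))
    (hB : ∀ j, MeasurableSet (B j)) (μ : Measure (∀ j, X j)) [IsFiniteMeasure μ] :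
    Integrable (winShare A B) μ :=
  Integrable.of_mem_Icc 0 1 (measurable_winShare hA hB).aemeasurable
    (ae_of_all _ (winShare_mem_Icc A B))

lemma integral_winShare_sub_le {A A' B B' : ∀ j, Set (X j)} (hA : ∀ j, A j ⊆ A' j)
    (hB : ∀ j, B j ⊆ B' j) (mA : ∀ j, MeasurableSet (A j)) (mB : ∀ j, MeasurableSet (B j))
    (mA' : ∀ j, MeasurableSet (A' j)) (mB' : ∀ j, MeasurableSet (B' j))
    (D : ∀ j, Measure (X j)) [∀ j, IsProbabilityMeasure (D j)] {c : ℝ}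
    (cA : ∀ j, (D j).real (A' j \ A j) ≤ c) (cB : ∀ j, (D j).real (B' j \ B j) ≤ c) :
    ∫ w, winShare A' B' w ∂(Measure.pi D) - ∫ w, winShare A B w ∂(Measure.pi D) ≤
      2 * Fintype.card ι * c := by
  have hi : ∀ (j : ι) {s : Set (X j)}, MeasurableSet s →
      Integrable (fun w : ∀ j, X j => s.indicator (1 : X j → ℝ) (w j)) (Measure.pi D) :=
    fun j s hs => Integrable.of_mem_Icc 0 1
      ((measurable_one.indicator hs).comp (measurable_pi_apply j)).aemeasurable
      (ae_of_all _ fun w => ⟨Set.indicator_nonneg (by simp) _,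
        Set.indicator_le_self' (f := (1 : X j → ℝ)) (by simp) _⟩)
  have hv : ∀ (j : ι) {s : Set (X j)}, MeasurableSet s →
      ∫ w, s.indicator (1 : X j → ℝ) (w j) ∂(Measure.pi D) = (D j).real s := by
    intro j s hs
    rw [← integral_indicator_one hs]
    have := integral_map (μ := Measure.pi D) (measurable_pi_apply j).aemeasurable
      (measurable_one.indicator hs : Measurable (s.indicator (1 : X j → ℝ))).aestronglyMeasurable
    rw [(measurePreserving_eval D j).map_eq] at this
    exact this.symm
  rw [← integral_sub (integrable_winShare mA' mB' _) (integrable_winShare mA mB _)]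
  refine (integral_mono ((integrable_winShare mA' mB' _).sub (integrable_winShare mA mB _))
    (integrable_finsetSum _ fun j _ => (hi j ((mA' j).diff (mA j))).add
      (hi j ((mB' j).diff (mB j)))) (winShare_sub_le hA hB)).trans ?_
  rw [integral_finsetSum _ fun j _ => (hi j ((mA' j).diff (mA j))).add
      (hi j ((mB' j).diff (mB j)))]
  calc _ ≤ ∑ _j : ι, 2 * c := Finset.sum_le_sum fun j _ => by
        rw [Pi.add_def, integral_add (hi j ((mA' j).diff (mA j))) (hi j ((mB' j).diff (mB j))),
          hv j ((mA' j).diff (mA j)), hv j ((mB' j).diff (mB j))]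
        linarith [cA j, cB j]
    _ = _ := by simp; ring

end WinShare

/-! ### Uniform estimation over all families of lower sets. -/

section Uniform

variable {ι : Type*} [Fintype ι] [DecidableEq ι] {X : ι → Type*} [∀ j, LinearOrder (X j)]
  [∀ j, TopologicalSpace (X j)] [∀ j, OrderClosedTopology (X j)]
  [∀ j, SecondCountableTopology (X j)] [∀ j, MeasurableSpace (X j)]
  [∀ j, OpensMeasurableSpace (X j)] {m : ℕ}

/-- With high probability the empirical product estimates the winning probability uniformly over
all families of lower sets. -/
lemma exists_uniform_winShare [NeZero m] (D : ∀ j, Measure (X j))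
    [∀ j, IsProbabilityMeasure (D j)] {N : ℕ} (hN : 0 < N) {e : ℝ} (he : 0 < e)
    (hNe : 4 * Fintype.card ι ≤ e * N) :
    ∃ G : Set (Fin m → ∀ j, X j), MeasurableSet G ∧
      (Measure.pi fun _ : Fin m => Measure.pi D).real Gᶜ ≤
        2 * (N : ℝ) ^ (2 * Fintype.card ι) * Real.exp (-(m * e ^ 2 / 2)) ∧
      ∀ S ∈ G, ∀ A B : ∀ j, Set (X j), (∀ j, IsLowerSet (A j)) → (∀ j, IsLowerSet (B j)) →
        |∫ w, winShare A B w ∂(Measure.pi (empirical S)) -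
          ∫ w, winShare A B w ∂(Measure.pi D)| ≤ e := by
  have hN0 : (0 : ℝ) < N := by exact_mod_cast hN
  choose lo hi hlo hhi hbr using fun j => exists_lowerSet_brackets (D j) hN
  -- The strict and weak sets are bracketed separately for each opponent, hence the exponent `2 *
  -- Fintype.card ι`.
  set K := ι → Fin N × Fin N
  set P := Measure.pi fun _ : Fin m => Measure.pi D with hP
  set l : K → (∀ j, X j) → ℝ := fun κ =>
    winShare (fun j => lo j (κ j).1) (fun j => lo j (κ j).2) with hl
  set u : K → (∀ j, X j) → ℝ := fun κ =>
    winShare (fun j => hi j (κ j).1) (fun j => hi j (κ j).2) with hu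
  have lm : ∀ κ, Measurable (l κ) := fun κ => measurable_winShare
    (fun j => IsLowerSet.measurableSet' (hlo j _)) (fun j => IsLowerSet.measurableSet' (hlo j _))
  have um : ∀ κ, Measurable (u κ) := fun κ => measurable_winShare
    (fun j => IsLowerSet.measurableSet' (hhi j _)) (fun j => IsLowerSet.measurableSet' (hhi j _))
  set E : K → Set (Fin m → ∀ j, X j) := fun κ =>
    {S | e / 2 ≤ ∫ w, u κ w ∂(Measure.pi (empirical S)) - ∫ w, u κ w ∂(Measure.pi D)} with hE
  set F : K → Set (Fin m → ∀ j, X j) := fun κ =>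
    {S | e / 2 ≤ ∫ w, -l κ w ∂(Measure.pi (empirical S)) - ∫ w, -l κ w ∂(Measure.pi D)} with hF
  have mE : ∀ κ, MeasurableSet (E κ) := fun κ =>
    measurableSet_le measurable_const ((measurable_integral_empirical (um κ)).sub_const _)
  have mF : ∀ κ, MeasurableSet (F κ) := fun κ =>
    measurableSet_le measurable_const ((measurable_integral_empirical (lm κ).neg).sub_const _)
  have hexp : -(2 * (m : ℝ) * (e / 2) ^ 2) = -(m * e ^ 2 / 2) := by ring
  have pE : ∀ κ, P.real (E κ) ≤ Real.exp (-(m * e ^ 2 / 2)) := fun κ => by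
    rw [← hexp]
    refine measure_empirical_sub_ge_le D (um κ) (a := 0) (fun x => ?_) (by positivity)
    rw [zero_add]; exact winShare_mem_Icc _ _ x
  have pF : ∀ κ, P.real (F κ) ≤ Real.exp (-(m * e ^ 2 / 2)) := fun κ => by
    rw [← hexp]
    refine measure_empirical_sub_ge_le D (lm κ).neg (a := -1) (fun x => ?_) (by positivity)
    have := winShare_mem_Icc (fun j => lo j (κ j).1) (fun j => lo j (κ j).2) x
    constructor <;> simp only [hl, Pi.neg_apply] <;> linarith [this.1, this.2]
  -- The good event involves only finitely many brackets, so it is measurable although the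
  -- conclusion ranges over all lower sets.
  refine ⟨(⋃ κ, (E κ ∪ F κ))ᶜ, (MeasurableSet.iUnion fun κ => (mE κ).union (mF κ)).compl, ?_, ?_⟩
  · rw [compl_compl]
    refine (measureReal_iUnion_fintype_le _).trans ?_
    calc ∑ κ, P.real (E κ ∪ F κ) ≤ ∑ _κ : K, 2 * Real.exp (-(m * e ^ 2 / 2)) :=
          Finset.sum_le_sum fun κ _ => (measureReal_union_le _ _).trans (by
            linarith [pE κ, pF κ])
      _ = _ := by
          simp only [Finset.sum_const, Finset.card_univ, nsmul_eq_mul, K, Fintype.card_fun,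
            Fintype.card_prod, Fintype.card_fin]
          push_cast
          rw [pow_mul, sq]
          ring
  · intro S hS A B hA hB
    simp only [Set.mem_compl_iff, Set.mem_iUnion, Set.mem_union, not_exists, not_or] at hS
    choose kA hA1 hA2 hA3 using fun j => hbr j (A j) (hA j)
    choose kB hB1 hB2 hB3 using fun j => hbr j (B j) (hB j)
    set κ : K := fun j => (kA j, kB j) with hκ
    obtain ⟨h1, h2⟩ := hS κ
    simp only [hE, hF, Set.mem_ofPred_eq, not_le, integral_neg] at h1 h2
    have mlo : ∀ j k, MeasurableSet (lo j k) := fun j k => IsLowerSet.measurableSet' (hlo j k)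
    have mhi : ∀ j k, MeasurableSet (hi j k) := fun j k => IsLowerSet.measurableSet' (hhi j k)
    have mA := fun j => IsLowerSet.measurableSet' (hA j)
    have mB := fun j => IsLowerSet.measurableSet' (hB j)
    -- Half of `e` pays for the bracket gap and half for sampling error. The gap is needed only
    -- under `D`; under the empirical measure monotonicity is enough.
    have hgap : (2 : ℝ) * Fintype.card ι * (1 / N) ≤ e / 2 := by
      rw [mul_one_div, div_le_iff₀ hN0]; linarith
    have l1 := fun (μ : Measure (∀ j, X j)) [IsProbabilityMeasure μ] =>
      integral_mono (μ := μ) (integrable_winShare (fun j => mlo j (kA j)) (fun j => mlo j (kB j)) μ)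
        (integrable_winShare mA mB μ) (winShare_mono hA1 hB1)
    have u1 := fun (μ : Measure (∀ j, X j)) [IsProbabilityMeasure μ] =>
      integral_mono (μ := μ) (integrable_winShare mA mB μ)
        (integrable_winShare (fun j => mhi j (kA j)) (fun j => mhi j (kB j)) μ)
        (winShare_mono hA2 hB2)
    have g1 := integral_winShare_sub_le hA1 hB1 (fun j => mlo j (kA j)) (fun j => mlo j (kB j))
      mA mB D (c := 1 / N)
      (fun j => (measureReal_mono (Set.sdiff_subset_sdiff_left (hA2 j))).trans (hA3 j))
      (fun j => (measureReal_mono (Set.sdiff_subset_sdiff_left (hB2 j))).trans (hB3 j))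
    have g2 := integral_winShare_sub_le hA2 hB2 mA mB
      (fun j => mhi j (kA j)) (fun j => mhi j (kB j)) D (c := 1 / N)
      (fun j => (measureReal_mono (Set.sdiff_subset_sdiff_right (hA1 j))).trans (hA3 j))
      (fun j => (measureReal_mono (Set.sdiff_subset_sdiff_right (hB1 j))).trans (hB3 j))
    have := l1 (Measure.pi (empirical S))
    have := u1 (Measure.pi (empirical S))
    simp only [hu, hl, hκ] at h1 h2
    rw [abs_le]
    constructor <;> linarith

end Uniform

/-! ### From winning probabilities to deviation gains. -/

section Regret

variable {n : ℕ} {H : ℝ} {T : Fin n → Set ℝ}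

/-- When `b` is maximal, the argmax consists of `i` and the opponents not strictly below `b`, which
explains the `1 +` in `winShare`. -/
lemma alloc_bidProfile (s : Strategy H T) (i : Fin n) (b : Bid H)
    (w : (j : {j : Fin n // j ≠ i}) → T j.1) :
    alloc i (bidProfile s i b w) =
      winShare (fun j : {j : Fin n // j ≠ i} => {v | s j v < b}) (fun j => {v | s j v ≤ b}) w := by
  classical
  have hi : bidProfile s i b w i = b := by simp [bidProfile]
  have hj : ∀ j : {j : Fin n // j ≠ i}, bidProfile s i b w j = s j (w j) := fun j => by
    simp [bidProfile, j.2]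
  have hall : (∀ j, bidProfile s i b w j ≤ bidProfile s i b w i) ↔
      ∀ j : {j : Fin n // j ≠ i}, w j ∈ {v | s j v ≤ b} := by
    rw [hi]
    constructor
    · intro h j
      have := h j
      rwa [hj] at this
    · intro h j
      by_cases hji : j = i
      · rw [hji, hi]
      · have := h ⟨j, hji⟩
        rw [hj ⟨j, hji⟩]
        exact this
  unfold alloc winShare
  by_cases h : ∀ j, bidProfile s i b w j ≤ bidProfile s i b w i
  · rw [if_pos h, if_pos (hall.1 h)]
    congr 1
    have hset : (Finset.univ.filter fun j : Fin n =>
        ∀ k, bidProfile s i b w k ≤ bidProfile s i b w j) =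
        insert i ((Finset.univ.filter fun j : {j : Fin n // j ≠ i} =>
          w j ∉ {v | s j v < b}).map (Function.Embedding.subtype _)) := by
      ext j
      simp only [Finset.mem_filter, Finset.mem_univ, true_and, Finset.mem_insert, Finset.mem_map,
        Function.Embedding.coe_subtype]
      constructor
      · intro hmax
        by_cases hji : j = i
        · exact Or.inl hji
        · refine Or.inr ⟨⟨j, hji⟩, ?_, rfl⟩
          have := hmax i
          rw [hi, hj ⟨j, hji⟩] at this
          exact not_lt.2 this
      · rintro (rfl | ⟨j, hjw, rfl⟩)
        · exact h
        · intro k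
          refine (h k).trans ?_
          rw [hi, hj]
          exact not_lt.1 hjw
    rw [hset, Finset.card_insert_of_notMem (by simp), Finset.card_map]
    push_cast
    ring
  · rw [if_neg h, if_neg (fun h' => h (hall.2 h'))]

/-- The interim winning probability of bidder `i` with bid `b`. -/
def winProb (D : (i : Fin n) → Measure (T i)) (i : Fin n) (b : Bid H) (s : Strategy H T) : ℝ :=
  ∫ w, winShare (fun j : {j : Fin n // j ≠ i} => {v | s j v < b}) (fun j => {v | s j v ≤ b}) w
    ∂(Measure.pi (fun j : {j : Fin n // j ≠ i} => D j.1))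

variable {s : Strategy H T}

lemma isLowerSet_bid_lt (hs : ∀ i, Monotone (s i)) (b : Bid H) (j : Fin n) :
    IsLowerSet {v | s j v < b} := fun _ _ hv h => (hs j hv).trans_lt h

lemma isLowerSet_bid_le (hs : ∀ i, Monotone (s i)) (b : Bid H) (j : Fin n) :
    IsLowerSet {v | s j v ≤ b} := fun _ _ hv h => (hs j hv).trans h

lemma integrable_winShare_bid (hs : ∀ i, Monotone (s i)) (i : Fin n) (b : Bid H)
    (μ : Measure ((j : {j : Fin n // j ≠ i}) → T j.1)) [IsFiniteMeasure μ] :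
    Integrable (winShare (fun j : {j : Fin n // j ≠ i} => {v | s j v < b})
      (fun j => {v | s j v ≤ b})) μ :=
  integrable_winShare (ι := {j : Fin n // j ≠ i})
    (fun j => IsLowerSet.measurableSet' (isLowerSet_bid_lt hs b j))
    (fun j => IsLowerSet.measurableSet' (isLowerSet_bid_le hs b j)) μ

lemma BNE_subset_of_deviation_gain {D E : (i : Fin n) → Measure (T i)}
    {f g : Fin n → Bid H → Set.Icc (0 : ℝ) H} {ε ε' : ℝ}
    (h : ∀ s : Strategy H T, (∀ i, Monotone (s i)) → ∀ (i : Fin n) (v : T i) (b b' : Bid H),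
      interimUtility f g D i v b' s - interimUtility f g D i v b s ≤
        interimUtility f g E i v b' s - interimUtility f g E i v b s + 2 * ε) :
    BNE f g E ε' ⊆ BNE f g D (ε' + 2 * ε) := by
  rintro s ⟨hs, hE⟩
  refine ⟨hs, fun i v b' => ?_⟩
  have h1 := h s hs i v (s i v) b'
  have h2 := hE i v b'
  linarith

variable (D : (i : Fin n) → Measure (T i)) [∀ i, IsProbabilityMeasure (D i)]

lemma winProb_mem_Icc (hs : ∀ i, Monotone (s i)) (i : Fin n) (b : Bid H) :
    winProb D i b s ∈ Set.Icc (0 : ℝ) 1 := by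
  refine ⟨integral_nonneg fun w => (winShare_mem_Icc _ _ w).1, ?_⟩
  refine (integral_mono (integrable_winShare_bid hs i b _) (integrable_const 1)
    fun w => (winShare_mem_Icc _ _ w).2).trans (by simp)

lemma winProb_mono (hs : ∀ i, Monotone (s i)) (i : Fin n) {b b' : Bid H} (hb : b ≤ b') :
    winProb D i b s ≤ winProb D i b' s :=
  integral_mono (integrable_winShare_bid hs i b _) (integrable_winShare_bid hs i b' _)
    (winShare_mono (fun _ _ h => lt_of_lt_of_le h hb) fun _ _ h => le_trans h hb)

lemma interimUtility_eq (f g : Fin n → Bid H → Set.Icc (0 : ℝ) H) (hs : ∀ i, Monotone (s i))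
    (i : Fin n) (v : ℝ) (b : Bid H) :
    interimUtility f g D i v b s = (v - f i b) * winProb D i b s - g i b := by
  have h : ∀ w : (j : {j : Fin n // j ≠ i}) → T j.1,
      exPostUtility f g i v (bidProfile s i b w) = (v - f i b) *
        winShare (fun j : {j : Fin n // j ≠ i} => {v | s j v < b}) (fun j => {v | s j v ≤ b}) w
          - g i b := by
    intro w
    have hi : bidProfile s i b w i = b := by simp [bidProfile]
    rw [exPostUtility, payment, alloc_bidProfile, hi]
    ring
  unfold interimUtility winProb
  simp_rw [h]
  rw [integral_sub ((integrable_winShare_bid hs i b _).const_mul _) (integrable_const _),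
    integral_const_mul]
  simp

lemma mul_add_mul_le_of_add_le_one {H a c x y : ℝ} (ha : 0 ≤ a) (ha' : a ≤ H) (hc : 0 ≤ c)
    (hc' : c ≤ H) (hx : x ≤ 1) (hy : y ≤ 1) (hxy : x + y ≤ 1) : a * x + c * y ≤ H := by
  have hH : 0 ≤ H := ha.trans ha'
  rcases le_total 0 x with h1 | h1 <;> rcases le_total 0 y with h2 | h2 <;>
    nlinarith [mul_nonneg (sub_nonneg.2 ha') (sub_nonneg.2 hx),
      mul_nonneg (sub_nonneg.2 hc') (sub_nonneg.2 hy), mul_nonneg hH (sub_nonneg.2 hxy)]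

variable {D} {E : (i : Fin n) → Measure (T i)} [∀ i, IsProbabilityMeasure (E i)]
  {f g : Fin n → Bid H → Set.Icc (0 : ℝ) H}

/-- The gain from a deviation changes by at most `H` between any two value distributions. -/
lemma deviation_gain_sub_le (hs : ∀ i, Monotone (s i)) (hH : 0 < H) {i : Fin n} {v : ℝ}
    (hv : v ∈ Set.Icc (0 : ℝ) H) (b b' : Bid H) :
    interimUtility f g D i v b' s - interimUtility f g D i v b s ≤
      interimUtility f g E i v b' s - interimUtility f g E i v b s + H := by
  simp only [interimUtility_eq _ f g hs]
  obtain ⟨α0, α1⟩ := (f i b').2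
  obtain ⟨β0, β1⟩ := (f i b).2
  set α : ℝ := (f i b').1
  set β : ℝ := (f i b).1
  obtain ⟨p0, p1⟩ := winProb_mem_Icc D hs i b
  obtain ⟨p0', p1'⟩ := winProb_mem_Icc D hs i b'
  obtain ⟨q0, q1⟩ := winProb_mem_Icc E hs i b
  obtain ⟨q0', q1'⟩ := winProb_mem_Icc E hs i b'
  -- Both distributions order the two winning probabilities in the same way; this yields `H` rather
  -- than `2 * H`.
  have hord : (winProb D i b s ≤ winProb D i b' s ∧ winProb E i b s ≤ winProb E i b' s) ∨
      (winProb D i b' s ≤ winProb D i b s ∧ winProb E i b' s ≤ winProb E i b s) :=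
    (le_total b b').imp (fun h => ⟨winProb_mono D hs i h, winProb_mono E hs i h⟩)
      fun h => ⟨winProb_mono D hs i h, winProb_mono E hs i h⟩
  set p := winProb D i b s
  set p' := winProb D i b' s
  set q := winProb E i b s
  set q' := winProb E i b' s
  -- The change in gain is affine in `v`, so it is bounded at `v = 0` (`h0`) and `v = H` (`h1`),
  -- then interpolated.
  have h0 : α * (q' - p') + β * (p - q) ≤ H :=
    mul_add_mul_le_of_add_le_one α0 α1 β0 β1 (by linarith) (by linarith)
      (by rcases hord with h | h <;> linarith [h.1, h.2])
  have h1 : (H - α) * (p' - q') + (H - β) * (q - p) ≤ H :=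
    mul_add_mul_le_of_add_le_one (by linarith) (by linarith) (by linarith) (by linarith)
      (by linarith) (by linarith) (by rcases hord with h | h <;> linarith [h.1, h.2])
  have h2 := mul_le_mul_of_nonneg_left h0 (sub_nonneg.2 hv.2)
  have h3 := mul_le_mul_of_nonneg_left h1 hv.1
  have h4 : H * ((v - α) * (p' - q') - (v - β) * (p - q)) ≤ H * H := by nlinarith
  have h5 := le_of_mul_le_mul_left h4 hH
  linarith

lemma deviation_gain_sub_le_of_winProb (hs : ∀ i, Monotone (s i)) (hH : 0 < H) {i : Fin n} {v : ℝ}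
    (hv : v ∈ Set.Icc (0 : ℝ) H) (b b' : Bid H) {ε : ℝ}
    (hb : |winProb D i b s - winProb E i b s| ≤ ε / H)
    (hb' : |winProb D i b' s - winProb E i b' s| ≤ ε / H) :
    interimUtility f g D i v b' s - interimUtility f g D i v b s ≤
      interimUtility f g E i v b' s - interimUtility f g E i v b s + 2 * ε := by
  simp only [interimUtility_eq _ f g hs]
  have key : ∀ (c : Bid H), |winProb D i c s - winProb E i c s| ≤ ε / H →
      |(v - f i c) * (winProb D i c s - winProb E i c s)| ≤ ε := by
    intro c hc
    rw [abs_mul]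
    have h1 : |v - f i c| ≤ H := by
      obtain ⟨h0, h1⟩ := (f i c).2
      rw [abs_le]
      constructor <;> linarith [hv.1, hv.2]
    calc _ ≤ H * (ε / H) := mul_le_mul h1 hc (abs_nonneg _) hH.le
      _ = ε := by field_simp
  have h1 := neg_le_of_abs_le (key b hb)
  have h2 := le_of_abs_le (key b' hb')
  linarith

end Regret

/-! ### Sample size and the union over bidders. -/

section Sampling

variable {n m : ℕ} {T : Fin n → Set ℝ}

instance isProbabilityMeasure_empMarginal [NeZero m] (S : Fin m → (i : Fin n) → T i) (i : Fin n) :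
    IsProbabilityMeasure (empMarginal S i) :=
  isProbabilityMeasure_empirical (X := fun i : Fin n => T i) S i

/-- Forgetting bidder `i` in every sample preserves the sampling measure. -/
lemma measurePreserving_sample_restrict (D : (i : Fin n) → Measure (T i))
    [∀ i, IsProbabilityMeasure (D i)] (i : Fin n) :
    MeasurePreserving (fun (S : Fin m → (i : Fin n) → T i) t (j : {j : Fin n // j ≠ i}) => S t j)
      (Measure.pi fun _ : Fin m => Measure.pi D)
      (Measure.pi fun _ : Fin m => Measure.pi fun j : {j : Fin n // j ≠ i} => D j.1) :=
  measurePreserving_pi _ _ fun _ => measurePreserving_fst.comp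
    (measurePreserving_piEquivPiSubtypeProd D fun j => j ≠ i)

/-- The union bound of the sample complexity. -/
lemma sample_size_bound {n : ℕ} (hn : 2 ≤ n) {e δ : ℝ} (he : 0 < e) (he2 : e < 1 / 2)
    (hδ : 0 < δ) (hδ1 : δ < 1) {m : ℝ}
    (hm : 32 * (n * Real.log n * Real.log (1 / e) + Real.log (n / δ)) ≤ m * e ^ 2) :
    n * (2 * (⌈4 * n / e⌉₊ : ℝ) ^ (2 * n) * Real.exp (-(m * e ^ 2 / 2))) ≤ δ := by
  have hn2 : (2 : ℝ) ≤ n := by exact_mod_cast hn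
  have hl2 := Real.log_two_gt_d9
  have ha : Real.log 2 ≤ Real.log n := Real.log_le_log (by norm_num) hn2
  have hL : Real.log 2 ≤ Real.log (1 / e) := by
    refine Real.log_le_log (by norm_num) ?_
    rw [le_div_iff₀ he]; linarith
  have hd : Real.log 2 ≤ Real.log (n / δ) := by
    refine Real.log_le_log (by norm_num) ?_
    rw [le_div_iff₀ hδ]; nlinarith
  -- The factor `8` absorbs `3 * log 2 + log n + log (1 / e)` into the product of logarithms, both
  -- being at least `log 2`. With the power `2 * n` and the `1/2` in the exponent it produces the
  -- constant `32`.
  have hN : (⌈4 * n / e⌉₊ : ℝ) ≤ Real.exp (8 * (Real.log n * Real.log (1 / e))) := by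
    have h1 : (⌈4 * n / e⌉₊ : ℝ) ≤ 8 * n * (1 / e) := by
      refine (Nat.ceil_lt_add_one (by positivity)).le.trans ?_
      have : 1 ≤ n / e := by rw [le_div_iff₀ he]; linarith
      have e1 : 4 * n / e = 4 * (n / e) := by ring
      have e2 : 8 * (n : ℝ) * (1 / e) = 8 * (n / e) := by ring
      rw [e1, e2]; linarith
    refine h1.trans ?_
    rw [← Real.log_le_iff_le_exp (by positivity), Real.log_mul (by positivity) (by positivity),
      Real.log_mul (by norm_num) (by positivity),
      show (8 : ℝ) = 2 ^ 3 by norm_num, Real.log_pow]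
    push_cast
    nlinarith [mul_nonneg (sub_nonneg.2 ha) (sub_nonneg.2 hL)]
  have hfac : (n : ℝ) * 2 = δ * Real.exp (Real.log 2 + Real.log (n / δ)) := by
    rw [Real.exp_add, Real.exp_log (by norm_num), Real.exp_log (by positivity)]
    field_simp
  calc n * (2 * (⌈4 * n / e⌉₊ : ℝ) ^ (2 * n) * Real.exp (-(m * e ^ 2 / 2)))
      ≤ n * (2 * Real.exp (8 * (Real.log n * Real.log (1 / e))) ^ (2 * n) *
          Real.exp (-(m * e ^ 2 / 2))) := by gcongr
    _ = δ * Real.exp (Real.log 2 + Real.log (n / δ) +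
          (2 * n : ℕ) * (8 * (Real.log n * Real.log (1 / e))) - m * e ^ 2 / 2) := by
        rw [← Real.exp_nat_mul, sub_eq_add_neg, Real.exp_add _ (-(m * e ^ 2 / 2)),
          Real.exp_add (Real.log 2 + Real.log (n / δ)), ← mul_assoc, ← mul_assoc, hfac]
        ring
    _ ≤ δ * 1 := by
        gcongr
        rw [Real.exp_le_one_iff]
        push_cast
        nlinarith
    _ = δ := mul_one δ

/-- With high probability all interim winning probabilities of monotone strategies are estimated
uniformly by the empirical product distribution. -/
lemma exists_uniform_winProb [NeZero m] (hn : 2 ≤ n) (D : (i : Fin n) → Measure (T i))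
    [∀ i, IsProbabilityMeasure (D i)] {e δ : ℝ} (he : 0 < e) (he2 : e < 1 / 2)
    (hδ : 0 < δ) (hδ1 : δ < 1)
    (hm : 32 * (n * Real.log n * Real.log (1 / e) + Real.log (n / δ)) ≤ m * e ^ 2) :
    ∃ G : Set (Fin m → (i : Fin n) → T i), MeasurableSet G ∧
      ENNReal.ofReal (1 - δ) ≤ (Measure.pi (fun _ : Fin m => Measure.pi D)) G ∧
      ∀ S ∈ G, ∀ (H : ℝ) (s : Strategy H T), (∀ i, Monotone (s i)) → ∀ (i : Fin n) (b : Bid H),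
        |winProb (empMarginal S) i b s - winProb D i b s| ≤ e := by
  set N := ⌈4 * n / e⌉₊ with hN
  have hn0 : (0 : ℝ) < n := by exact_mod_cast (by omega : 0 < n)
  have hN0 : 0 < N := Nat.ceil_pos.2 (by positivity)
  have hcard : ∀ i : Fin n, Fintype.card {j : Fin n // j ≠ i} ≤ n := fun i =>
    (Fintype.card_subtype_le _).trans (by simp)
  have hNe : ∀ i : Fin n, 4 * (Fintype.card {j : Fin n // j ≠ i} : ℝ) ≤ e * N := fun i => by
    have h1 : (Fintype.card {j : Fin n // j ≠ i} : ℝ) ≤ n := by exact_mod_cast hcard i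
    have h2 : 4 * n / e ≤ (N : ℝ) := Nat.le_ceil _
    rw [div_le_iff₀ he] at h2
    linarith
  choose G hGm hGp hG using fun i : Fin n =>
    exists_uniform_winShare (m := m) (fun j : {j : Fin n // j ≠ i} => D j.1) hN0 he (hNe i)
  set P := Measure.pi (fun _ : Fin m => Measure.pi D)
  have hR := fun i => measurePreserving_sample_restrict (m := m) D i
  set R := fun i (S : Fin m → (i : Fin n) → T i) t (j : {j : Fin n // j ≠ i}) => S t j
  have hmeas : MeasurableSet (⋂ i, R i ⁻¹' G i) :=
    MeasurableSet.iInter fun i => (hR i).measurable (hGm i)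
  refine ⟨⋂ i, R i ⁻¹' G i, hmeas, ?_, ?_⟩
  · have hc : P.real (⋂ i, R i ⁻¹' G i)ᶜ ≤ δ := by
      rw [Set.compl_iInter]
      refine (measureReal_iUnion_fintype_le _).trans
        (le_trans ?_ (sample_size_bound hn he he2 hδ hδ1 hm))
      calc ∑ i, P.real (R i ⁻¹' G i)ᶜ
          ≤ ∑ _i : Fin n, 2 * (N : ℝ) ^ (2 * n) * Real.exp (-(m * e ^ 2 / 2)) := by
            refine Finset.sum_le_sum fun i _ => ?_
            rw [← Set.preimage_compl, (hR i).measureReal_preimage (hGm i).compl.nullMeasurableSet]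
            refine (hGp i).trans ?_
            gcongr
            · exact_mod_cast hN0
            · exact hcard i
        _ = _ := by simp [hN]
    rw [probReal_compl_eq_one_sub hmeas] at hc
    rw [← ofReal_measureReal]
    exact ENNReal.ofReal_le_ofReal (by linarith)
  · intro S hS H s hs i b
    -- By unfolding, the opponents' marginals of `empMarginal S` are the `empirical` marginals of `R
    -- i S`.
    exact hG i _ (Set.mem_iInter.1 hS i) _ _ (fun j => isLowerSet_bid_lt hs b j)
      (fun j => isLowerSet_bid_le hs b j)

end Sampling

end BayesAuction

end

/-! ### Assembly: the two degenerate cases and the sampling regime. -/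

theorem mainTheorem8 :
    ∃ C : ℝ, 0 < C ∧
      ∀ (n : ℕ) (_ : 0 < n) (H : ℝ) (_ : 0 < H)
        (f g : Fin n → BayesAuction.Bid H → Set.Icc (0 : ℝ) H)
        (T : Fin n → Set ℝ) (_ : ∀ i, T i ⊆ Set.Icc (0 : ℝ) H)
        (D : (i : Fin n) → Measure (T i)) (_ : ∀ i, IsProbabilityMeasure (D i))
        (ε ε' δ : ℝ) (_ : 0 < ε) (_ : 0 < ε') (_ : 0 < δ) (_ : δ < 1)
        (m : ℕ) (_ : 1 ≤ m)
        (_ : C * (H ^ 2 / ε ^ 2 *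
              ((n : ℝ) * Real.log n * Real.log (H / ε) + Real.log ((n : ℝ) / δ))) ≤ (m : ℝ)),
        -- with probability at least `1 - δ` over `m` i.i.d. samples from `∏ i, D i`
        ∃ G : Set (Fin m → (i : Fin n) → T i),
          MeasurableSet G ∧
          ENNReal.ofReal (1 - δ) ≤ (Measure.pi (fun _ : Fin m => Measure.pi D)) G ∧
          ∀ S ∈ G,
            BayesAuction.BNE f g (BayesAuction.empMarginal S) ε' ⊆
                BayesAuction.BNE f g D (ε' + 2 * ε) ∧
              BayesAuction.BNE f g D ε' ⊆
                BayesAuction.BNE f g (BayesAuction.empMarginal S) (ε' + 2 * ε) := by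
  refine ⟨32, by norm_num, ?_⟩
  intro n hn H hH f g T hT D hD ε ε' δ hε _ hδ hδ1 m hm hmC
  have : NeZero m := ⟨by omega⟩
  have huniv : ENNReal.ofReal (1 - δ) ≤
      (Measure.pi (fun _ : Fin m => Measure.pi D)) Set.univ := by
    rw [measure_univ, ← ENNReal.ofReal_one]
    exact ENNReal.ofReal_le_ofReal (by linarith)
  by_cases hεH : H ≤ 2 * ε
  · refine ⟨Set.univ, MeasurableSet.univ, huniv, fun S _ => ⟨?_, ?_⟩⟩ <;>
    · refine BayesAuction.BNE_subset_of_deviation_gain fun s hs i v b b' => ?_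
      exact (BayesAuction.deviation_gain_sub_le hs hH (hT i v.2) b b').trans (by linarith)
  -- Here `log n = 0`, but both opponent distributions are the same measure on a one-point space.
  by_cases hn1 : n = 1
  · subst hn1
    refine ⟨Set.univ, MeasurableSet.univ, huniv, fun S _ => ?_⟩
    have heq : ∀ (i : Fin 1) (v : ℝ) (b : BayesAuction.Bid H) (s : BayesAuction.Strategy H T),
        BayesAuction.interimUtility f g (BayesAuction.empMarginal S) i v b s =
          BayesAuction.interimUtility f g D i v b s := by
      intro i v b s
      have : IsEmpty {j : Fin 1 // j ≠ i} := ⟨fun j => j.2 (Subsingleton.elim _ _)⟩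
      unfold BayesAuction.interimUtility
      rw [Measure.pi_of_empty, Measure.pi_of_empty]
    constructor <;>
    · refine BayesAuction.BNE_subset_of_deviation_gain fun s hs i v b b' => ?_
      simp only [heq]
      linarith
  · have he : 0 < ε / H := by positivity
    have he2 : ε / H < 1 / 2 := by rw [div_lt_iff₀ hH]; linarith
    have hmC' : 32 * (n * Real.log n * Real.log (1 / (ε / H)) + Real.log (n / δ)) ≤
        m * (ε / H) ^ 2 := by
      rw [one_div_div]
      have := mul_le_mul_of_nonneg_right hmC (sq_nonneg (ε / H))
      refine le_trans (le_of_eq ?_) this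
      field_simp
    obtain ⟨G, hG, hGp, hGu⟩ :=
      BayesAuction.exists_uniform_winProb (m := m) (by omega : 2 ≤ n) D he he2 hδ hδ1 hmC'
    refine ⟨G, hG, hGp, fun S hS => ⟨?_, ?_⟩⟩ <;>
    · refine BayesAuction.BNE_subset_of_deviation_gain fun s hs i v b b' => ?_
      refine BayesAuction.deviation_gain_sub_le_of_winProb hs hH (hT i v.2) b b' ?_ ?_
      all_goals first
        | exact hGu S hS H s hs i _
        | rw [abs_sub_comm]; exact hGu S hS H s hs i _
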